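/- Let $n\ge 1$, let $X\in\mathbb R^{n\times n}$ be a matrix of rank $r$, and let $\mu_1\in\mathbb R$ satisfy $\|X\|_\infty\le \mu_1\sqrt{r/n^2}\,\|X\|$. Here $\|\cdot\|$ is the spectral norm, $\|\cdot\|_F$ the Frobenius norm, and $\|\cdot\|_\infty$ the maximum magnitude of the entries. Let $\Omega=(\omega_1,\dots,\omega_m)$ consist of $m$ indices drawn independently and uniformly, with replacement, from $\{1,\dots,n\}\times\{1,\dots,n\}$. Put $p=m/n^2$, and let $\mathcal P_\Omega(Z)$ be the entrywise product of $Z$ with $\sum_{k=1}^m e_{i_k}e_{j_k}^{*}$, where $\omega_k=(i_k,j_k)$ (repeated indices are counted with multiplicity). Let $X_0=\mathcal H_r\left(p^{-1}\mathcal P_\Omega(X)\right)$. Here $\mathcal H_r(Z)=P\Lambda_rQ^{*}$ for a singular value decomposition $Z=P\Lambda Q^{*}$ with singular values in nonincreasing order, and $\Lambda_r$ keeps the $r$ largest singular values and sets the others to zero. Then for every $\beta>1$, if $m\ge 6\beta n\log n$, with probability at least $1-2n^{1-\beta}$ the bound $$\|X_0-X\|_F\le\sqrt{\frac{64\,\beta\,\mu_1^2\,n\,r^2\log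 n}{3m}}\;\|X\|$$ holds, simultaneously for all choices of the singular value decomposition that defines $\mathcal H_r$. -/

import Mathlib

open MeasureTheory ProbabilityTheory
open scoped Matrix

namespace MatrixCompletion

/-- Spectral norm `‖A‖` (the operator norm for the Euclidean norm). -/
noncomputable def specNorm {n : ℕ} (A : Matrix (Fin n) (Fin n) ℝ) : ℝ :=
  ‖Matrix.toEuclideanCLM (n := Fin n) (𝕜 := ℝ) A‖

open scoped Matrix.Norms.Frobenius in
/-- Frobenius norm `‖A‖_F`. -/
noncomputable def frobNorm {n : ℕ} (A : Matrix (Fin n) (Fin n) ℝ) : ℝ := ‖A‖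

open scoped Matrix.Norms.Elementwise in
/-- Maximum magnitude of the entries, `‖A‖_∞`. -/
noncomputable def maxNorm {n : ℕ} (A : Matrix (Fin n) (Fin n) ℝ) : ℝ := ‖A‖

/-- The sampling operator `P_Ω`: the entrywise product with `∑_{(i,j) ∈ Ω} e_i e_jᵀ`, where
`Ω` is a family of `m` index pairs, counted with multiplicity. -/
def sampling {n m : ℕ} (Ω : Fin m → Fin n × Fin n) (Z : Matrix (Fin n) (Fin n) ℝ) :
    Matrix (Fin n) (Fin n) ℝ :=
  Z ⊙ ∑ k, Matrix.single (Ω k).1 (Ω k).2 (1 : ℝ)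

/-- `Z = P Λ Qᵀ` is a singular value decomposition, with `Λ = diag(s)`: `P` and `Q` are
orthogonal and the entries of `s` are nonnegative and nonincreasing. -/
structure IsSVD {n : ℕ} (Z P : Matrix (Fin n) (Fin n) ℝ) (s : Fin n → ℝ)
    (Q : Matrix (Fin n) (Fin n) ℝ) : Prop where
  left_mem : P ∈ Matrix.orthogonalGroup (Fin n) ℝ
  right_mem : Q ∈ Matrix.orthogonalGroup (Fin n) ℝ
  nonneg : ∀ i, 0 ≤ s i
  antitone : Antitone s
  eq : Z = P * Matrix.diagonal s * Qᵀ

/-- `Y` is a value of the hard thresholding operator `H_r` at `Z`: for some singular value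
decomposition of `Z`, all but the `r` largest singular values have been set to zero.
(The value is unique unless the `r`-th and the next singular value are equal and nonzero.) -/
def IsHardThresholding {n : ℕ} (r : ℕ) (Z Y : Matrix (Fin n) (Fin n) ℝ) : Prop :=
  ∃ (P : Matrix (Fin n) (Fin n) ℝ) (s : Fin n → ℝ) (Q : Matrix (Fin n) (Fin n) ℝ),
    IsSVD Z P s Q ∧
      Y = P * Matrix.diagonal (fun i : Fin n => if (i : ℕ) < r then s i else 0) * Qᵀ

/-- Every square real matrix has a singular value decomposition. -/
theorem exists_isSVD {n : ℕ} (Z : Matrix (Fin n) (Fin n) ℝ) :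
    ∃ (P : Matrix (Fin n) (Fin n) ℝ) (s : Fin n → ℝ) (Q : Matrix (Fin n) (Fin n) ℝ),
      IsSVD Z P s Q := by
  set T : EuclideanSpace ℝ (Fin n) →ₗ[ℝ] EuclideanSpace ℝ (Fin n) := Matrix.toEuclideanLin Z
    with hT
  have hn : Module.finrank ℝ (EuclideanSpace ℝ (Fin n)) = n := finrank_euclideanSpace_fin
  have hsym := T.isSymmetric_adjoint_comp_self
  set v := hsym.eigenvectorBasis hn with hv
  set s : Fin n → ℝ := fun i => T.singularValues i with hs
  have hs0 : ∀ i, 0 ≤ s i := fun i => T.singularValues_nonneg i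
  have hinner : ∀ i j, inner ℝ (T (v i)) (T (v j)) = if i = j then s i ^ 2 else 0 := by
    intro i j
    have h1 : inner ℝ (T (v i)) (T (v j)) = inner ℝ ((LinearMap.adjoint T ∘ₗ T) (v i)) (v j) := by
      simp [LinearMap.adjoint_inner_left]
    rw [h1, hv, hsym.apply_eigenvectorBasis hn i, inner_smul_left,
      orthonormal_iff_ite.mp (hsym.eigenvectorBasis hn).orthonormal i j]
    have := T.sq_singularValues_fin hn i
    simp [hs, this]
  set w : Fin n → EuclideanSpace ℝ (Fin n) := fun i => (s i)⁻¹ • T (v i) with hw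
  have hort : Orthonormal ℝ (({i | s i ≠ 0} : Set (Fin n)).domRestrict w) := by
    rw [orthonormal_iff_ite]
    rintro ⟨i, hi⟩ ⟨j, hj⟩
    change s i ≠ 0 at hi
    have h2 : inner ℝ (w i) (w j) = if i = j then (1 : ℝ) else 0 := by
      simp only [hw, inner_smul_left, inner_smul_right, hinner]
      split_ifs with h
      · subst h
        simp only [conj_trivial]
        field_simp
      · simp
    simp only [Subtype.mk.injEq]
    exact h2
  obtain ⟨u, hu⟩ := hort.exists_orthonormalBasis_extension_of_card_eq (by simp)
  have hTv : ∀ i, T (v i) = s i • u i := by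
    intro i
    by_cases hi : s i = 0
    · have := hinner i i
      simp [hi] at this
      simp [hi, this]
    · rw [hu i hi]
      simp [hw, smul_smul, hi]
  have horth : ∀ b : OrthonormalBasis (Fin n) ℝ (EuclideanSpace ℝ (Fin n)),
      (Matrix.of fun i j => b j i) ∈ Matrix.orthogonalGroup (Fin n) ℝ := by
    intro b
    rw [Matrix.mem_orthogonalGroup_iff']
    ext i j
    have := orthonormal_iff_ite.mp b.orthonormal i j
    rw [PiLp.inner_apply] at this
    simp only [RCLike.inner_apply, conj_trivial] at this
    rw [Matrix.mul_apply, Matrix.one_apply, ← this]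
    refine Finset.sum_congr rfl fun k _ => ?_
    simp [mul_comm]
  refine ⟨Matrix.of fun i j => u j i, s, Matrix.of fun i j => v j i, horth u, horth v, hs0,
    fun i j hij => T.singularValues_antitone hij, ?_⟩
  have hQ := (Matrix.mem_orthogonalGroup_iff (Fin n) ℝ).mp (horth v)
  have hZQ : Z * (Matrix.of fun i j => v j i)
      = (Matrix.of fun i j => u j i) * Matrix.diagonal s := by
    ext i j
    have h := congrArg (fun x : EuclideanSpace ℝ (Fin n) => x i) (hTv j)
    simp only [hT, PiLp.smul_apply, smul_eq_mul] at h
    rw [Matrix.mul_diagonal, Matrix.mul_apply, Matrix.of_apply, mul_comm, ← h]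
    simp [Matrix.toLpLin_apply, Matrix.mulVec, dotProduct]
  rw [← hZQ, Matrix.mul_assoc]
  rw [show (Matrix.of fun i j => v j i) * (Matrix.of fun i j => v j i)ᵀ = 1 from hQ,
    Matrix.mul_one]

/-- The hard thresholding operator takes at least one value at every matrix. -/
theorem exists_isHardThresholding {n : ℕ} (r : ℕ) (Z : Matrix (Fin n) (Fin n) ℝ) :
    ∃ Y, IsHardThresholding r Z Y := by
  obtain ⟨P, s, Q, h⟩ := exists_isSVD Z
  exact ⟨_, P, s, Q, h, rfl⟩

end MatrixCompletion

/-! The rescaled sample minus `X` is the mean of `m` independent centred matrices, each of the form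
`n² X_ij e_i e_jᵀ - X`. With `B` the max norm of `X`, their spectral norms are at most `3/2 n² B`
and their row and column variances at most `n³ B²`. The matrix Bernstein inequality
(`card_lt_specNorm_mul_exp_le`) then makes the spectral error at most `τ = √(8βn³ log n / (3m)) B`
outside an event of probability `2 n^(1-β)`.

The rest is deterministic (`IsHardThresholding.frobNorm_sub_le`). The thresholded matrix differs
from `X` by rank at most `2r`, and by Eckart–Young its spectral distance to `X` is at most twice
that of the untruncated matrix. So the Frobenius error is at most `√(2r) · 2τ`, and the bound on `B`
turns this into the stated constant. No particular decomposition is singled out, so all choices are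
covered at once.

Bernstein is proved by the Ahlswede–Winter method: dilate to symmetric matrices, bound the trace
exponential one sample at a time by Golden–Thompson, then apply a Chernoff argument. Sampling is
uniform on a finite set, so expectations become sums over all samples and probabilities become
counts. -/

namespace MatrixCompletion

/-! ### Trace inequalities for powers of two. -/

section Trace

variable {ι : Type*} [Fintype ι]

theorem trace_mul_pow_comm [DecidableEq ι] (A B : Matrix ι ι ℝ) (k : ℕ) :
    ((A * B) ^ k).trace = ((B * A) ^ k).trace := by
  cases k with
  | zero => simp
  | succ k =>
    have h : ∀ j : ℕ, (A * B) ^ (j + 1) = A * ((B * A) ^ j * B) := by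
      intro j
      induction j with
      | zero => simp
      | succ j ih => rw [pow_succ, ih, pow_succ]; simp only [Matrix.mul_assoc]
    rw [h, Matrix.trace_mul_comm, pow_succ, Matrix.mul_assoc]

theorem trace_mul_transpose_self_nonneg (A : Matrix ι ι ℝ) : 0 ≤ (A * Aᵀ).trace := by
  simpa using (Matrix.posSemidef_self_mul_conjTranspose A).trace_nonneg

/-- Expand the nonnegative trace of `(A - Aᵀ)(A - Aᵀ)ᵀ`. -/
theorem trace_mul_self_le (A : Matrix ι ι ℝ) : (A * A).trace ≤ (A * Aᵀ).trace := by
  have h := trace_mul_transpose_self_nonneg (A - Aᵀ)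
  have h2 : (Aᵀ * Aᵀ).trace = (A * A).trace := by
    rw [← Matrix.transpose_mul, Matrix.trace_transpose]
  have h3 : (Aᵀ * A).trace = (A * Aᵀ).trace := Matrix.trace_mul_comm _ _
  simp only [Matrix.transpose_sub, Matrix.transpose_transpose, sub_mul, mul_sub,
    Matrix.trace_sub] at h
  linarith

theorem two_mul_trace_mul_le {A B : Matrix ι ι ℝ} (hA : Aᵀ = A) (hB : Bᵀ = B) :
    2 * (A * B).trace ≤ (A * A).trace + (B * B).trace := by
  have h := trace_mul_transpose_self_nonneg (A - B)
  have h2 : (B * A).trace = (A * B).trace := Matrix.trace_mul_comm _ _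
  simp only [Matrix.transpose_sub, hA, hB, sub_mul, mul_sub, Matrix.trace_sub] at h
  linarith

variable [DecidableEq ι]

/-- Two trace inequalities for powers of two, proved by a joint induction. -/
theorem trace_pow_two_pow_aux (k : ℕ) :
    (∀ P Q : Matrix ι ι ℝ, Pᵀ = P → Qᵀ = Q →
      ((P * Q) ^ 2 ^ k).trace ≤ (P ^ 2 ^ k * Q ^ 2 ^ k).trace) ∧
    ∀ A : Matrix ι ι ℝ, (A ^ 2 ^ (k + 1)).trace ≤ ((A * Aᵀ) ^ 2 ^ k).trace := by
  induction k with
  | zero =>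
    refine ⟨fun P Q _ _ => by simp, fun A => ?_⟩
    simpa [pow_two] using trace_mul_self_le A
  | succ k ih =>
    obtain ⟨ih₁, ih₂⟩ := ih
    constructor
    · intro P Q hP hQ
      -- The second inequality at level `k` for `P * Q`, then cyclicity, leaves a product of the
      -- symmetric squares `P²` and `Q²`, to which the first inequality at level `k` applies.
      calc ((P * Q) ^ 2 ^ (k + 1)).trace ≤ ((P * Q * (P * Q)ᵀ) ^ 2 ^ k).trace := ih₂ _
        _ = ((P * (Q * Q * P)) ^ 2 ^ k).trace := by
          rw [Matrix.transpose_mul, hP, hQ]; simp only [Matrix.mul_assoc]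
        _ = ((Q * Q * (P * P)) ^ 2 ^ k).trace := by
          rw [trace_mul_pow_comm]; simp only [Matrix.mul_assoc]
        _ = ((P * P * (Q * Q)) ^ 2 ^ k).trace := trace_mul_pow_comm _ _ _
        _ ≤ ((P * P) ^ 2 ^ k * (Q * Q) ^ 2 ^ k).trace :=
          ih₁ _ _ (by rw [Matrix.transpose_mul, hP]) (by rw [Matrix.transpose_mul, hQ])
        _ = _ := by rw [← pow_two, ← pow_two, ← pow_mul, ← pow_mul, ← pow_succ']
    · intro A
      have hs₁ : (Aᵀ * A)ᵀ = Aᵀ * A := by simp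
      have hs₂ : (A * Aᵀ)ᵀ = A * Aᵀ := by simp
      -- Powers of `Aᵀ A` and `A Aᵀ` have equal traces, so this mean inequality bounds their mixed
      -- trace by a single one.
      have h := two_mul_trace_mul_le (A := (Aᵀ * A) ^ 2 ^ k) (B := (A * Aᵀ) ^ 2 ^ k)
        (by rw [Matrix.transpose_pow, hs₁]) (by rw [Matrix.transpose_pow, hs₂])
      rw [← pow_two, ← pow_two, ← pow_mul, ← pow_mul, ← pow_succ, trace_mul_pow_comm Aᵀ A] at h
      calc (A ^ 2 ^ (k + 1 + 1)).trace = ((A * A) ^ 2 ^ (k + 1)).trace := by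
            rw [← pow_two, ← pow_mul, ← pow_succ']
        _ ≤ ((A * A * (A * A)ᵀ) ^ 2 ^ k).trace := ih₂ _
        _ = ((A * (A * Aᵀ * Aᵀ)) ^ 2 ^ k).trace := by
          rw [Matrix.transpose_mul]; simp only [Matrix.mul_assoc]
        _ = ((A * Aᵀ * (Aᵀ * A)) ^ 2 ^ k).trace := by
          rw [trace_mul_pow_comm]; simp only [Matrix.mul_assoc]
        _ = ((Aᵀ * A * (A * Aᵀ)) ^ 2 ^ k).trace := trace_mul_pow_comm _ _ _
        _ ≤ ((Aᵀ * A) ^ 2 ^ k * (A * Aᵀ) ^ 2 ^ k).trace := ih₁ _ _ hs₁ hs₂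
        _ ≤ _ := by linarith

theorem trace_mul_pow_two_pow_le {P Q : Matrix ι ι ℝ} (hP : Pᵀ = P) (hQ : Qᵀ = Q) (k : ℕ) :
    ((P * Q) ^ 2 ^ k).trace ≤ (P ^ 2 ^ k * Q ^ 2 ^ k).trace :=
  (trace_pow_two_pow_aux k).1 P Q hP hQ

end Trace

/-! ### The Lie product formula. -/

section Lie

open NormedSpace Filter Topology

variable {𝔸 : Type*} [NormedRing 𝔸] [NormOneClass 𝔸]

/-- Telescoping: swap one factor `x` for `y` at a time. -/
theorem norm_pow_sub_pow_le {x y : 𝔸} {c : ℝ} (hx : ‖x‖ ≤ c) (hy : ‖y‖ ≤ c) (k : ℕ) :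
    ‖x ^ (k + 1) - y ^ (k + 1)‖ ≤ (k + 1) * c ^ k * ‖x - y‖ := by
  have hc : 0 ≤ c := (norm_nonneg x).trans hx
  induction k with
  | zero => simp
  | succ k ih =>
    have h : x ^ (k + 1 + 1) - y ^ (k + 1 + 1)
        = x * (x ^ (k + 1) - y ^ (k + 1)) + (x - y) * y ^ (k + 1) := by
      rw [pow_succ' x (k + 1), pow_succ' y (k + 1)]; noncomm_ring
    calc ‖x ^ (k + 1 + 1) - y ^ (k + 1 + 1)‖
        ≤ ‖x‖ * ‖x ^ (k + 1) - y ^ (k + 1)‖ + ‖x - y‖ * ‖y ^ (k + 1)‖ := by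
          rw [h]
          exact (norm_add_le _ _).trans (add_le_add (norm_mul_le _ _) (norm_mul_le _ _))
      _ ≤ c * ((k + 1) * c ^ k * ‖x - y‖) + ‖x - y‖ * c ^ (k + 1) := by
          gcongr
          exact (norm_pow_le _ _).trans (by gcongr)
      _ = _ := by push_cast; ring

variable [NormedAlgebra ℝ 𝔸]

theorem norm_exp_le_exp_norm (x : 𝔸) : ‖exp x‖ ≤ Real.exp ‖x‖ := by
  have h : HasSum (fun k : ℕ => ‖x‖ ^ k / (k.factorial : ℝ)) (Real.exp ‖x‖) := by
    rw [Real.exp_eq_exp_ℝ]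
    exact expSeries_div_hasSum_exp ‖x‖
  rw [exp_eq_tsum ℝ]
  refine tsum_of_norm_bounded h fun k => ?_
  rw [norm_smul, norm_inv, Real.norm_natCast, div_eq_inv_mul]
  gcongr
  exact norm_pow_le _ _

variable [CompleteSpace 𝔸]

/-- The Lie product formula. -/
theorem tendsto_exp_mul_exp_pow (a b : 𝔸) :
    Tendsto (fun k : ℕ => (exp (((k : ℝ) + 1)⁻¹ • a) * exp (((k : ℝ) + 1)⁻¹ • b)) ^ (k + 1))
      atTop (𝓝 (exp (a + b))) := by
  let _ : NormedAlgebra ℚ 𝔸 := NormedAlgebra.restrictScalars ℚ ℝ 𝔸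
  set f : ℝ → 𝔸 := fun t => exp (t • a) * exp (t • b) - exp (t • (a + b)) with hf
  -- The splitting error `f` vanishes to first order at `0`, so it is `o(t)`; this absorbs the
  -- factor `k + 1` lost in telescoping with `t = 1/(k+1)`.
  have hd : HasDerivAt f 0 0 := by
    have h1 := hasDerivAt_exp_smul_const a (0 : ℝ)
    have h2 := hasDerivAt_exp_smul_const b (0 : ℝ)
    have h3 := hasDerivAt_exp_smul_const (a + b) (0 : ℝ)
    convert! (h1.mul h2).sub h3 using 1
    simp
  have hf0 : f 0 = 0 := by simp [hf]
  have hlim : Tendsto (fun k : ℕ => ((k : ℝ) + 1) * ‖f ((k : ℝ) + 1)⁻¹‖) atTop (𝓝 0) := by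
    have h := hd.tendsto_slope_zero
    have hk : Tendsto (fun k : ℕ => ((k : ℝ) + 1)⁻¹) atTop (𝓝[≠] 0) := by
      refine tendsto_nhdsWithin_iff.2 ⟨?_, ?_⟩
      · simpa [one_div] using tendsto_one_div_add_atTop_nhds_zero_nat (𝕜 := ℝ)
      · exact Eventually.of_forall fun k => by
          have : (0 : ℝ) < ((k : ℝ) + 1)⁻¹ := by positivity
          exact this.ne'
    have h2 := (h.comp hk).norm
    simp only [norm_zero] at h2
    refine h2.congr fun k => ?_
    have : (0 : ℝ) ≤ (k : ℝ) + 1 := by positivity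
    simp [hf0, norm_smul, abs_of_nonneg this]
  have hexp : ∀ x : 𝔸, ‖exp x‖ ≤ Real.exp ‖x‖ := norm_exp_le_exp_norm
  set C := ‖a‖ + ‖b‖ with hC
  have key : ∀ k : ℕ, ‖(exp (((k : ℝ) + 1)⁻¹ • a) * exp (((k : ℝ) + 1)⁻¹ • b)) ^ (k + 1)
      - exp (a + b)‖ ≤ Real.exp C * (((k : ℝ) + 1) * ‖f ((k : ℝ) + 1)⁻¹‖) := by
    intro k
    set t : ℝ := ((k : ℝ) + 1)⁻¹ with ht
    have ht0 : 0 < t := by positivity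
    have hkt : ((k : ℝ) + 1) * t = 1 := mul_inv_cancel₀ (by positivity)
    have hx : ‖exp (t • a) * exp (t • b)‖ ≤ Real.exp (t * C) := by
      refine (norm_mul_le _ _).trans ?_
      rw [hC, mul_add, Real.exp_add]
      have h1 := hexp (t • a)
      have h2 := hexp (t • b)
      rw [norm_smul, Real.norm_of_nonneg ht0.le] at h1 h2
      gcongr
    have hy : ‖exp (t • (a + b))‖ ≤ Real.exp (t * C) := by
      refine (hexp _).trans ?_
      rw [norm_smul, Real.norm_of_nonneg ht0.le]
      have := norm_add_le a b
      gcongr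
    have h := norm_pow_sub_pow_le hx hy k
    have hpow : exp (t • (a + b)) ^ (k + 1) = exp (a + b) := by
      rw [← exp_nsmul, ← Nat.cast_smul_eq_nsmul ℝ, smul_smul]
      push_cast
      rw [hkt, one_smul]
    rw [hpow] at h
    refine h.trans ?_
    have hle : Real.exp (t * C) ^ k ≤ Real.exp C := by
      rw [← Real.exp_nat_mul]
      refine Real.exp_le_exp.2 ?_
      have hC0 : 0 ≤ C := by positivity
      have : (k : ℝ) * t ≤ 1 := by nlinarith
      calc (k : ℝ) * (t * C) = (k * t) * C := by ring
        _ ≤ 1 * C := by gcongr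
        _ = C := one_mul C
    calc ((k : ℝ) + 1) * Real.exp (t * C) ^ k * ‖exp (t • a) * exp (t • b) - exp (t • (a + b))‖
        ≤ ((k : ℝ) + 1) * Real.exp C * ‖f t‖ := by gcongr
      _ = _ := by ring
  refine tendsto_iff_norm_sub_tendsto_zero.2 ?_
  refine squeeze_zero (fun _ => norm_nonneg _) key ?_
  simpa using hlim.const_mul (Real.exp C)

end Lie

/-! ### The Golden–Thompson inequality. -/

open NormedSpace Filter Topology in
open scoped Matrix.Norms.L2Operator in
/-- The Golden–Thompson inequality for real symmetric matrices. -/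
theorem trace_exp_add_le {ι : Type*} [Fintype ι] [DecidableEq ι] {A B : Matrix ι ι ℝ}
    (hA : Aᵀ = A) (hB : Bᵀ = B) :
    (exp (A + B)).trace ≤ (exp A * exp B).trace := by
  cases isEmpty_or_nonempty ι
  · simp [Matrix.trace]
  have hlim := tendsto_exp_mul_exp_pow A B
  -- The trace inequality is available only for exponents `2 ^ k`. The Lie sequence has exponent one
  -- more than its index, hence the subsequence `2 ^ k - 1`.
  have hsub : Tendsto (fun k : ℕ => 2 ^ k - 1) atTop atTop :=
    tendsto_atTop_mono (fun k => Nat.le_sub_one_of_lt k.lt_two_pow_self) tendsto_id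
  have hcont : Continuous fun M : Matrix ι ι ℝ => M.trace := continuous_id.matrix_trace
  refine le_of_tendsto ((hcont.tendsto _).comp (hlim.comp hsub)) (Eventually.of_forall fun k => ?_)
  have h1 : 2 ^ k - 1 + 1 = 2 ^ k := Nat.sub_add_cancel Nat.one_le_two_pow
  have h2 : ((2 ^ k - 1 : ℕ) : ℝ) + 1 = ((2 ^ k : ℕ) : ℝ) := by exact_mod_cast h1
  simp only [Function.comp_apply, h1, h2]
  set t : ℝ := ((2 ^ k : ℕ) : ℝ)⁻¹ with ht
  have hs : ∀ M : Matrix ι ι ℝ, Mᵀ = M → (exp (t • M))ᵀ = exp (t • M) := fun M hM => by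
    rw [← Matrix.exp_transpose, Matrix.transpose_smul, hM]
  have hp : ∀ M : Matrix ι ι ℝ, exp (t • M) ^ 2 ^ k = exp M := fun M => by
    rw [← Matrix.exp_nsmul, ← Nat.cast_smul_eq_nsmul ℝ, smul_smul, ht,
      mul_inv_cancel₀ (by positivity), one_smul]
  have := trace_mul_pow_two_pow_le (hs A hA) (hs B hB) k
  rwa [hp, hp] at this

open NormedSpace

/-- Since `(k + 2)! ≥ 2 · 3 ^ k`, the Taylor tail from degree two is dominated by a geometric series
of ratio `c / 3`. -/
theorem exp_le_one_add_add_sq {x c : ℝ} (hx : |x| ≤ c) (hc : c < 3) :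
    Real.exp x ≤ 1 + x + (2 * (1 - c / 3))⁻¹ * x ^ 2 := by
  have hc0 : 0 ≤ c := (abs_nonneg x).trans hx
  have h1 : HasSum (fun k : ℕ => x ^ k / (k.factorial : ℝ)) (Real.exp x) := by
    rw [Real.exp_eq_exp_ℝ]
    exact expSeries_div_hasSum_exp x
  have h2 := (hasSum_nat_add_iff' 2).2 h1
  have h3 : HasSum (fun k : ℕ => x ^ 2 / 2 * (c / 3) ^ k) (x ^ 2 / 2 * (1 - c / 3)⁻¹) :=
    (hasSum_geometric_of_lt_one (by positivity) (by linarith)).mul_left _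
  have h4 := hasSum_le (fun k => ?_) h2 h3
  · simp only [Finset.sum_range_succ, Finset.sum_range_zero] at h4
    norm_num at h4
    rw [mul_inv]
    linarith
  · have hfac : (2 * 3 ^ k : ℝ) ≤ ((k + 2).factorial : ℝ) := by
      have := Nat.factorial_mul_pow_le_factorial (m := 2) (n := k)
      rw [add_comm 2 k] at this
      exact_mod_cast this
    calc x ^ (k + 2) / ((k + 2).factorial : ℝ) ≤ |x| ^ (k + 2) / ((k + 2).factorial : ℝ) := by
          rw [← abs_pow]
          gcongr
          exact le_abs_self _
      _ ≤ |x| ^ (k + 2) / (2 * 3 ^ k) := by gcongr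
      _ = x ^ 2 / 2 * (|x| ^ k / 3 ^ k) := by rw [pow_add, sq_abs]; field_simp
      _ ≤ x ^ 2 / 2 * (c ^ k / 3 ^ k) := by gcongr
      _ = _ := by rw [div_pow]

/-! ### Matrix exponentials and the trace moment bound. -/

section Symmetric

variable {ι : Type*} [Fintype ι] [DecidableEq ι]

theorem exists_diagonalization {Y : Matrix ι ι ℝ} (hY : Yᵀ = Y) :
    ∃ (U : Matrix ι ι ℝ) (d : ι → ℝ), U * Uᵀ = 1 ∧ Uᵀ * U = 1 ∧
      Y = U * Matrix.diagonal d * Uᵀ := by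
  have hH : Y.IsHermitian := by simpa [Matrix.IsHermitian] using hY
  refine ⟨hH.eigenvectorUnitary, hH.eigenvalues, ?_, ?_, ?_⟩
  · simpa [Matrix.star_eq_conjTranspose] using Unitary.coe_mul_star_self hH.eigenvectorUnitary
  · simpa [Matrix.star_eq_conjTranspose] using Unitary.coe_star_mul_self hH.eigenvectorUnitary
  · conv_lhs => rw [hH.spectral_theorem, Unitary.conjStarAlgAut_apply]
    simp [Matrix.star_eq_conjTranspose]

theorem exp_conj_diagonal {U : Matrix ι ι ℝ} (h₁ : U * Uᵀ = 1) (d : ι → ℝ) :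
    exp (U * Matrix.diagonal d * Uᵀ) = U * Matrix.diagonal (fun i => Real.exp (d i)) * Uᵀ := by
  have hi : U⁻¹ = Uᵀ := Matrix.inv_eq_right_inv h₁
  rw [← hi, Matrix.exp_conj _ _ (IsUnit.of_mul_eq_one _ h₁), Matrix.exp_diagonal]
  congr 3
  funext i
  rw [Pi.coe_exp, Real.exp_eq_exp_ℝ]

theorem posSemidef_conj_diagonal (U : Matrix ι ι ℝ) {d : ι → ℝ} (hd : ∀ i, 0 ≤ d i) :
    (U * Matrix.diagonal d * Uᵀ).PosSemidef := by
  simpa using (Matrix.posSemidef_diagonal_iff.2 hd).mul_mul_conjTranspose_same U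

theorem nonneg_of_posSemidef_conj_diagonal {U : Matrix ι ι ℝ} (h₂ : Uᵀ * U = 1) {d : ι → ℝ}
    (h : (U * Matrix.diagonal d * Uᵀ).PosSemidef) (i : ι) : 0 ≤ d i := by
  have h' := h.conjTranspose_mul_mul_same U
  have he : Uᴴ * (U * Matrix.diagonal d * Uᵀ) * U = Matrix.diagonal d := by
    rw [Matrix.conjTranspose_eq_transpose_of_trivial,
      show Uᵀ * (U * Matrix.diagonal d * Uᵀ) * U = (Uᵀ * U) * Matrix.diagonal d * (Uᵀ * U) by
        simp only [Matrix.mul_assoc], h₂, one_mul, mul_one]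
  rw [he] at h'
  exact Matrix.posSemidef_diagonal_iff.1 h' i

theorem posSemidef_exp {Y : Matrix ι ι ℝ} (hY : Yᵀ = Y) : (exp Y).PosSemidef := by
  obtain ⟨U, d, h₁, -, rfl⟩ := exists_diagonalization hY
  rw [exp_conj_diagonal h₁]
  exact posSemidef_conj_diagonal U fun i => (Real.exp_pos _).le

/-- In an eigenbasis of `A` the trace pairs nonnegative eigenvalues with the nonnegative diagonal of
the conjugated `B`. -/
theorem trace_mul_nonneg {A B : Matrix ι ι ℝ} (hA : A.PosSemidef) (hB : B.PosSemidef) :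
    0 ≤ (A * B).trace := by
  obtain ⟨U, d, -, h₂, rfl⟩ := exists_diagonalization (Y := A) (by simpa using hA.1.eq)
  have hd := nonneg_of_posSemidef_conj_diagonal h₂ hA
  have h := hB.conjTranspose_mul_mul_same U
  rw [Matrix.conjTranspose_eq_transpose_of_trivial] at h
  rw [show U * Matrix.diagonal d * Uᵀ * B = U * (Matrix.diagonal d * Uᵀ * B) by
    simp only [Matrix.mul_assoc], Matrix.trace_mul_comm,
    show Matrix.diagonal d * Uᵀ * B * U = Matrix.diagonal d * (Uᵀ * B * U) by
      simp only [Matrix.mul_assoc]]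
  simp only [Matrix.trace, Matrix.diag_apply, Matrix.diagonal_mul]
  exact Finset.sum_nonneg fun i _ => mul_nonneg (hd i) h.diag_nonneg

/-- If `Y² ≤ c²` with `c < 3`, then `exp Y ≤ 1 + Y + Y² / (2 (1 - c / 3))`. -/
theorem posSemidef_quadratic_sub_exp {Y : Matrix ι ι ℝ} (hY : Yᵀ = Y) {c : ℝ} (hc₀ : 0 ≤ c)
    (hc : c < 3) (hYc : (c ^ 2 • (1 : Matrix ι ι ℝ) - Y * Y).PosSemidef) :
    (1 + Y + (2 * (1 - c / 3))⁻¹ • (Y * Y) - exp Y).PosSemidef := by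
  obtain ⟨U, d, h₁, h₂, rfl⟩ := exists_diagonalization hY
  have hone : ∀ a : ℝ, a • (1 : Matrix ι ι ℝ) = U * Matrix.diagonal (fun _ => a) * Uᵀ := fun a => by
    rw [← Matrix.smul_one_eq_diagonal, Matrix.mul_smul, Matrix.smul_mul, mul_one, h₁]
  have hsq : U * Matrix.diagonal d * Uᵀ * (U * Matrix.diagonal d * Uᵀ)
      = U * Matrix.diagonal (fun i => d i * d i) * Uᵀ := by
    rw [show U * Matrix.diagonal d * Uᵀ * (U * Matrix.diagonal d * Uᵀ)
      = U * (Matrix.diagonal d * (Uᵀ * U) * Matrix.diagonal d) * Uᵀ by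
        simp only [Matrix.mul_assoc], h₂, mul_one, Matrix.diagonal_mul_diagonal]
  have hd : ∀ i, |d i| ≤ c := by
    rw [hsq, hone, ← sub_mul, ← mul_sub, Matrix.diagonal_sub] at hYc
    intro i
    have := nonneg_of_posSemidef_conj_diagonal h₂ hYc i
    exact abs_le_of_sq_le_sq (by nlinarith) hc₀
  have he : 1 + U * Matrix.diagonal d * Uᵀ
      + (2 * (1 - c / 3))⁻¹ • (U * Matrix.diagonal d * Uᵀ * (U * Matrix.diagonal d * Uᵀ))
      - exp (U * Matrix.diagonal d * Uᵀ)
      = U * Matrix.diagonal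
        (fun i => 1 + d i + (2 * (1 - c / 3))⁻¹ * (d i * d i) - Real.exp (d i)) * Uᵀ := by
    rw [hsq, exp_conj_diagonal h₁, ← one_smul ℝ (1 : Matrix ι ι ℝ), hone, ← Matrix.smul_mul,
      ← Matrix.mul_smul, ← Matrix.diagonal_smul, ← add_mul, ← mul_add, ← add_mul, ← mul_add,
      ← sub_mul, ← mul_sub, Matrix.diagonal_add, Matrix.diagonal_add, Matrix.diagonal_sub]
    rfl
  rw [he]
  refine posSemidef_conj_diagonal U fun i => ?_
  have := exp_le_one_add_add_sq (hd i) hc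
  rw [← pow_two]
  linarith

/-- Some eigenvalue exceeds `t`, and its exponential is one of the positive summands of the trace.
This is the Chernoff step. -/
theorem exp_le_trace_exp {Y : Matrix ι ι ℝ} (hY : Yᵀ = Y) {t : ℝ}
    (h : ¬ (t • (1 : Matrix ι ι ℝ) - Y).PosSemidef) {θ : ℝ} (hθ : 0 ≤ θ) :
    Real.exp (θ * t) ≤ (exp (θ • Y)).trace := by
  obtain ⟨U, d, h₁, h₂, rfl⟩ := exists_diagonalization hY
  obtain ⟨i, hi⟩ : ∃ i, t < d i := by
    by_contra! hd
    refine h ?_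
    have : t • (1 : Matrix ι ι ℝ) - U * Matrix.diagonal d * Uᵀ
        = U * Matrix.diagonal (fun i => t - d i) * Uᵀ := by
      rw [← Matrix.diagonal_sub, mul_sub, sub_mul, ← Matrix.smul_one_eq_diagonal,
        Matrix.mul_smul, Matrix.smul_mul, mul_one, h₁]
    rw [this]
    exact posSemidef_conj_diagonal U fun i => sub_nonneg.2 (hd i)
  have he : θ • (U * Matrix.diagonal d * Uᵀ) = U * Matrix.diagonal (fun i => θ * d i) * Uᵀ := by
    rw [← Matrix.smul_mul, ← Matrix.mul_smul, ← Matrix.diagonal_smul]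
    rfl
  rw [he, exp_conj_diagonal h₁, Matrix.trace_mul_comm, ← Matrix.mul_assoc, h₂, one_mul,
    Matrix.trace_diagonal]
  calc Real.exp (θ * t) ≤ Real.exp (θ * d i) := by gcongr
    _ ≤ _ := Finset.single_le_sum (f := fun i => Real.exp (θ * d i))
      (fun _ _ => (Real.exp_pos _).le) (Finset.mem_univ i)

/-- One step of the Ahlswede–Winter argument, iterated. -/
theorem sum_trace_exp_le {I : Type*} [Fintype I] {Y : I → Matrix ι ι ℝ} (hY : ∀ i, (Y i)ᵀ = Y i)
    {K : ℝ} (hK : (K • (1 : Matrix ι ι ℝ) - ∑ i, exp (Y i)).PosSemidef) (hK₀ : 0 ≤ K) (m : ℕ)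
    {H : Matrix ι ι ℝ} (hH : Hᵀ = H) :
    ∑ w : Fin m → I, (exp (H + ∑ k, Y (w k))).trace ≤ K ^ m * (exp H).trace := by
  induction m generalizing H with
  | zero => simp
  | succ m ih =>
    rw [← (Fin.consEquiv fun _ : Fin (m + 1) => I).sum_comp, Fintype.sum_prod_type]
    simp only [Fin.consEquiv_apply, Fin.sum_univ_succ, Fin.cons_zero, Fin.cons_succ, ← add_assoc]
    -- Golden–Thompson splits off `exp (Y i)`; pairing with the positive semidefinite `exp H` then
    -- allows the sum of these to be replaced by `K`.
    have hstep : ∑ i, (exp (H + Y i)).trace ≤ K * (exp H).trace := by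
      have h := trace_mul_nonneg (posSemidef_exp hH) hK
      rw [mul_sub, Matrix.trace_sub, Matrix.mul_smul, mul_one, Matrix.trace_smul, smul_eq_mul,
        Finset.mul_sum, Matrix.trace_sum] at h
      have := Finset.sum_le_sum fun i (_ : i ∈ Finset.univ) => trace_exp_add_le hH (hY i)
      linarith
    calc _ ≤ ∑ i, K ^ m * (exp (H + Y i)).trace := Finset.sum_le_sum fun i _ =>
          ih (by rw [Matrix.transpose_add, hH, hY])
      _ = K ^ m * ∑ i, (exp (H + Y i)).trace := by rw [Finset.mul_sum]
      _ ≤ K ^ m * (K * (exp H).trace) := by gcongr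
      _ = _ := by ring

/-- Summing the quadratic bound on each `exp (θ • Y i)` removes the linear term by centring and
leaves the variance. Then `1 + x ≤ exp x` gives the exponential form. -/
theorem sum_trace_exp_smul_le {I : Type*} [Fintype I] [Nonempty I] {Y : I → Matrix ι ι ℝ}
    (hY : ∀ i, (Y i)ᵀ = Y i) (hsum : ∑ i, Y i = 0) {M V θ : ℝ} (hM : 0 ≤ M) (hV : 0 ≤ V)
    (hθ : 0 ≤ θ) (hθM : θ * M < 3)
    (hYM : ∀ i, (M ^ 2 • (1 : Matrix ι ι ℝ) - Y i * Y i).PosSemidef)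
    (hYV : ((Fintype.card I * V) • (1 : Matrix ι ι ℝ) - ∑ i, Y i * Y i).PosSemidef) (m : ℕ) :
    ∑ w : Fin m → I, (exp (θ • ∑ k, Y (w k))).trace ≤
      (Fintype.card I : ℝ) ^ m * Real.exp (m * ((2 * (1 - θ * M / 3))⁻¹ * θ ^ 2 * V))
        * Fintype.card ι := by
  set g := (2 * (1 - θ * M / 3))⁻¹ with hg
  have hg₀ : 0 ≤ g := inv_nonneg.2 (by linarith)
  have hq : ∀ i, (1 + θ • Y i + g • (θ • Y i * θ • Y i) - exp (θ • Y i)).PosSemidef := fun i => by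
    refine posSemidef_quadratic_sub_exp (by rw [Matrix.transpose_smul, hY])
      (mul_nonneg hθ hM) hθM ?_
    convert (hYM i).smul (sq_nonneg θ) using 1
    rw [smul_sub, smul_smul, ← mul_pow, Matrix.smul_mul, Matrix.mul_smul, smul_smul, pow_two θ]
  set K : ℝ := Fintype.card I * (1 + g * θ ^ 2 * V) with hKdef
  have hK₀ : 0 ≤ K := by positivity
  have hK : (K • (1 : Matrix ι ι ℝ) - ∑ i, exp (θ • Y i)).PosSemidef := by
    convert (Matrix.posSemidef_sum Finset.univ fun i _ => hq i).add
      (hYV.smul (mul_nonneg hg₀ (sq_nonneg θ))) using 1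
    simp only [Finset.sum_sub_distrib, Finset.sum_add_distrib, ← Finset.smul_sum, hsum,
      Matrix.smul_mul, Matrix.mul_smul, Finset.sum_const, Finset.card_univ, smul_sub, smul_smul,
      smul_zero, ← Nat.cast_smul_eq_nsmul ℝ]
    rw [show g * (θ * θ) = g * θ ^ 2 by ring, hKdef, mul_add, add_smul]
    rw [show g * θ ^ 2 * (Fintype.card I * V) = Fintype.card I * (g * θ ^ 2 * V) by ring, mul_one]
    abel
  have h := sum_trace_exp_le (Y := fun i => θ • Y i) (fun i => by rw [Matrix.transpose_smul, hY])
    hK hK₀ m (H := 0) (Matrix.transpose_zero)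
  simp only [zero_add, ← Finset.smul_sum, exp_zero, Matrix.trace_one] at h
  refine h.trans ?_
  rw [hKdef, mul_pow, Real.exp_nat_mul]
  gcongr
  rw [add_comm]
  exact Real.add_one_le_exp _

end Symmetric

end MatrixCompletion

namespace MatrixCompletion

open NormedSpace

/-! ### The spectral norm through quadratic forms. -/

section SpecNorm

variable {n : ℕ}

theorem specNorm_nonneg (A : Matrix (Fin n) (Fin n) ℝ) : 0 ≤ specNorm A := norm_nonneg _

theorem specNorm_add_le (A B : Matrix (Fin n) (Fin n) ℝ) :
    specNorm (A + B) ≤ specNorm A + specNorm B := by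
  simpa [specNorm] using norm_add_le (Matrix.toEuclideanCLM (n := Fin n) (𝕜 := ℝ) A)
    (Matrix.toEuclideanCLM (n := Fin n) (𝕜 := ℝ) B)

theorem specNorm_smul (c : ℝ) (A : Matrix (Fin n) (Fin n) ℝ) :
    specNorm (c • A) = |c| * specNorm A := by
  simp [specNorm, norm_smul]

theorem specNorm_neg (A : Matrix (Fin n) (Fin n) ℝ) : specNorm (-A) = specNorm A := by
  simp [specNorm]

theorem specNorm_transpose (A : Matrix (Fin n) (Fin n) ℝ) : specNorm Aᵀ = specNorm A := by
  have := Matrix.l2_opNorm_conjTranspose A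
  rwa [Matrix.conjTranspose_eq_transpose_of_trivial] at this

theorem norm_toLp_sq (v : Fin n → ℝ) : ‖WithLp.toLp 2 v‖ ^ 2 = v ⬝ᵥ v := by
  rw [EuclideanSpace.real_norm_sq_eq, dotProduct]
  simp [pow_two]

theorem mulVec_dotProduct_mulVec_le (A : Matrix (Fin n) (Fin n) ℝ) (v : Fin n → ℝ) :
    A *ᵥ v ⬝ᵥ A *ᵥ v ≤ specNorm A ^ 2 * (v ⬝ᵥ v) := by
  have h := (Matrix.toEuclideanCLM (n := Fin n) (𝕜 := ℝ) A).le_opNorm (WithLp.toLp 2 v)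
  rw [Matrix.toEuclideanCLM_toLp] at h
  rw [← norm_toLp_sq, ← norm_toLp_sq, ← mul_pow]
  exact pow_le_pow_left₀ (norm_nonneg _) h 2

theorem specNorm_le {A : Matrix (Fin n) (Fin n) ℝ} {t : ℝ} (ht : 0 ≤ t)
    (h : ∀ v, A *ᵥ v ⬝ᵥ A *ᵥ v ≤ t ^ 2 * (v ⬝ᵥ v)) : specNorm A ≤ t := by
  refine ContinuousLinearMap.opNorm_le_bound _ ht fun x => ?_
  have h' := h x.ofLp
  rw [← norm_toLp_sq, ← norm_toLp_sq, ← mul_pow] at h'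
  exact le_of_sq_le_sq h' (by positivity)

theorem specNorm_le_of_sum_sq_le {A : Matrix (Fin n) (Fin n) ℝ} {t : ℝ} (ht : 0 ≤ t)
    (h : ∑ i, ∑ j, A i j ^ 2 ≤ t ^ 2) : specNorm A ≤ t := by
  refine specNorm_le ht fun v => ?_
  have hv : v ⬝ᵥ v = ∑ j, v j ^ 2 := by simp [dotProduct, pow_two]
  have hv₀ : 0 ≤ v ⬝ᵥ v := by rw [hv]; positivity
  calc A *ᵥ v ⬝ᵥ A *ᵥ v = ∑ i, (∑ j, A i j * v j) ^ 2 := by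
        simp [dotProduct, Matrix.mulVec, pow_two]
    _ ≤ ∑ i, (∑ j, A i j ^ 2) * ∑ j, v j ^ 2 :=
      Finset.sum_le_sum fun i _ => Finset.sum_mul_sq_le_sq_mul_sq _ _ _
    _ = (∑ i, ∑ j, A i j ^ 2) * (v ⬝ᵥ v) := by rw [Finset.sum_mul, hv]
    _ ≤ _ := by gcongr

theorem posSemidef_smul_one_sub_transpose_mul {A : Matrix (Fin n) (Fin n) ℝ} {M : ℝ}
    (hA : specNorm A ≤ M) : (M ^ 2 • (1 : Matrix (Fin n) (Fin n) ℝ) - Aᵀ * A).PosSemidef := by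
  refine Matrix.PosSemidef.of_dotProduct_mulVec_nonneg ?_ fun v => ?_
  · simp [Matrix.IsHermitian]
  · have h := mulVec_dotProduct_mulVec_le A v
    have h2 : specNorm A ^ 2 * (v ⬝ᵥ v) ≤ M ^ 2 * (v ⬝ᵥ v) := by
      have := specNorm_nonneg A
      have : 0 ≤ v ⬝ᵥ v := by rw [← norm_toLp_sq]; positivity
      gcongr
    rw [star_trivial, Matrix.sub_mulVec, Matrix.smul_mulVec, Matrix.one_mulVec, dotProduct_sub,
      dotProduct_smul, smul_eq_mul, ← Matrix.mulVec_mulVec, Matrix.dotProduct_mulVec,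
      Matrix.vecMul_transpose]
    linarith

end SpecNorm

/-! ### Hermitian dilation and matrix Bernstein. -/

section Dilation

variable {n : ℕ}

/-- The Hermitian dilation of a square matrix. -/
def dilation (A : Matrix (Fin n) (Fin n) ℝ) : Matrix (Fin n ⊕ Fin n) (Fin n ⊕ Fin n) ℝ :=
  Matrix.fromBlocks 0 A Aᵀ 0

theorem dilation_transpose (A : Matrix (Fin n) (Fin n) ℝ) : (dilation A)ᵀ = dilation A := by
  simp [dilation, Matrix.fromBlocks_transpose]

theorem dilation_mul_self (A : Matrix (Fin n) (Fin n) ℝ) :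
    dilation A * dilation A = Matrix.fromBlocks (A * Aᵀ) 0 0 (Aᵀ * A) := by
  simp [dilation, Matrix.fromBlocks_multiply]

theorem dilation_sum {J : Type*} (s : Finset J) (A : J → Matrix (Fin n) (Fin n) ℝ) :
    dilation (∑ j ∈ s, A j) = ∑ j ∈ s, dilation (A j) := by
  ext (i | i) (j | j) <;> simp [dilation, Matrix.sum_apply]

theorem posSemidef_fromBlocks_zero {A D : Matrix (Fin n) (Fin n) ℝ} (hA : A.PosSemidef)
    (hD : D.PosSemidef) : (Matrix.fromBlocks A 0 0 D).PosSemidef := by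
  refine Matrix.PosSemidef.of_dotProduct_mulVec_nonneg ?_ fun v => ?_
  · exact Matrix.IsHermitian.fromBlocks hA.1 (by simp) hD.1
  · rw [Matrix.fromBlocks_mulVec, dotProduct, Fintype.sum_sum_type]
    have h₁ := hA.dotProduct_mulVec_nonneg (v ∘ Sum.inl)
    have h₂ := hD.dotProduct_mulVec_nonneg (v ∘ Sum.inr)
    simp only [dotProduct, star_trivial] at h₁ h₂
    simpa using add_nonneg h₁ h₂

theorem smul_one_sub_fromBlocks (c : ℝ) (A D : Matrix (Fin n) (Fin n) ℝ) :
    c • (1 : Matrix (Fin n ⊕ Fin n) (Fin n ⊕ Fin n) ℝ) - Matrix.fromBlocks A 0 0 D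
      = Matrix.fromBlocks (c • 1 - A) 0 0 (c • 1 - D) := by
  rw [← Matrix.fromBlocks_one, Matrix.fromBlocks_smul]
  ext (i | i) (j | j) <;> simp

/-- On the test vector `(A v, t v)` the form equals `t (t² |v|² - |A v|²)`, so semidefiniteness
would force the norm to be at most `t`. -/
theorem not_posSemidef_of_lt_specNorm {A : Matrix (Fin n) (Fin n) ℝ} {t : ℝ} (ht : 0 < t)
    (hA : t < specNorm A) :
    ¬ (t • (1 : Matrix (Fin n ⊕ Fin n) (Fin n ⊕ Fin n) ℝ) - dilation A).PosSemidef := by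
  intro h
  refine hA.not_ge (specNorm_le ht.le fun v => ?_)
  have hv := h.dotProduct_mulVec_nonneg (Sum.elim (A *ᵥ v) (t • v))
  have h1 : v ⬝ᵥ Aᵀ *ᵥ (A *ᵥ v) = A *ᵥ v ⬝ᵥ A *ᵥ v := by
    rw [Matrix.dotProduct_mulVec, Matrix.vecMul_transpose]
  have h2 : star (Sum.elim (A *ᵥ v) (t • v)) ⬝ᵥ
      (t • (1 : Matrix (Fin n ⊕ Fin n) (Fin n ⊕ Fin n) ℝ) - dilation A) *ᵥ
        Sum.elim (A *ᵥ v) (t • v) = t * (t ^ 2 * (v ⬝ᵥ v) - A *ᵥ v ⬝ᵥ A *ᵥ v) := by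
    rw [star_trivial, Matrix.sub_mulVec, Matrix.smul_mulVec, Matrix.one_mulVec, dotProduct_sub,
      dotProduct_smul, dilation, Matrix.fromBlocks_mulVec]
    simp only [Sum.elim_comp_inl, Sum.elim_comp_inr, Matrix.zero_mulVec, zero_add, smul_zero,
      add_zero, sumElim_dotProduct_sumElim, Matrix.mulVec_smul, dotProduct_smul,
      smul_dotProduct, smul_eq_mul, h1]
    ring
  rw [h2] at hv
  have := nonneg_of_mul_nonneg_right hv ht
  linarith

/-- The matrix Bernstein inequality for uniform sampling from a finite family, in the form of
a bound on the number of bad samples. -/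
theorem card_lt_specNorm_mul_exp_le {I : Type*} [Fintype I] [Nonempty I]
    {W : I → Matrix (Fin n) (Fin n) ℝ} (hsum : ∑ i, W i = 0) {M V θ t : ℝ} (hM : 0 ≤ M)
    (hV : 0 ≤ V) (hθ : 0 ≤ θ) (hθM : θ * M < 3) (ht : 0 < t) (hWM : ∀ i, specNorm (W i) ≤ M)
    (hWV : ((Fintype.card I * V) • (1 : Matrix (Fin n) (Fin n) ℝ)
      - ∑ i, W i * (W i)ᵀ).PosSemidef)
    (hWV' : ((Fintype.card I * V) • (1 : Matrix (Fin n) (Fin n) ℝ)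
      - ∑ i, (W i)ᵀ * W i).PosSemidef) (m : ℕ) :
    (Set.ncard {w : Fin m → I | t < specNorm (∑ k, W (w k))} : ℝ) * Real.exp (θ * t) ≤
      (Fintype.card I : ℝ) ^ m * Real.exp (m * ((2 * (1 - θ * M / 3))⁻¹ * θ ^ 2 * V))
        * (2 * n) := by
  classical
  have h := sum_trace_exp_smul_le (Y := fun i => dilation (W i))
    (fun i => dilation_transpose _) (by rw [← dilation_sum, hsum]; simp [dilation]) hM hV hθ hθM
    (fun i => by
      rw [dilation_mul_self, smul_one_sub_fromBlocks]
      refine posSemidef_fromBlocks_zero ?_ (posSemidef_smul_one_sub_transpose_mul (hWM i))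
      simpa using posSemidef_smul_one_sub_transpose_mul (A := (W i)ᵀ)
        (by rw [specNorm_transpose]; exact hWM i))
    (by
      have : ∑ i, dilation (W i) * dilation (W i)
          = Matrix.fromBlocks (∑ i, W i * (W i)ᵀ) 0 0 (∑ i, (W i)ᵀ * W i) := by
        simp only [dilation_mul_self]
        ext (i | i) (j | j) <;> simp [Matrix.sum_apply]
      rw [this, smul_one_sub_fromBlocks]
      exact posSemidef_fromBlocks_zero hWV hWV') m
  simp only [Fintype.card_sum, Fintype.card_fin, ← two_mul, Nat.cast_mul, Nat.cast_ofNat] at h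
  refine le_trans ?_ h
  rw [Set.ncard_eq_toFinset_card', ← nsmul_eq_mul, ← Finset.sum_const]
  -- Each bad sample contributes at least `exp (θ t)` to the trace sum, and the other terms are
  -- nonnegative.
  refine le_trans (Finset.sum_le_sum fun w hw => ?_)
    (Finset.sum_le_sum_of_subset_of_nonneg (Finset.subset_univ _) fun w _ _ => ?_)
  · rw [← dilation_sum]
    exact exp_le_trace_exp (dilation_transpose _)
      (not_posSemidef_of_lt_specNorm ht (by simpa using hw)) hθ
  · rw [← dilation_sum]
    exact (posSemidef_exp (by rw [Matrix.transpose_smul, dilation_transpose])).trace_nonneg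

end Dilation

/-! ### Bernstein parameters for entry sampling. -/

section Sampling

variable {n : ℕ}

/-- The centred single-entry sample `n² X_ij e_i e_jᵀ - X`. -/
def centeredSample (X : Matrix (Fin n) (Fin n) ℝ) (i : Fin n × Fin n) :
    Matrix (Fin n) (Fin n) ℝ :=
  (n : ℝ) ^ 2 • Matrix.single i.1 i.2 (X i.1 i.2) - X

theorem sum_single_eq (X : Matrix (Fin n) (Fin n) ℝ) :
    ∑ i : Fin n × Fin n, Matrix.single i.1 i.2 (X i.1 i.2) = X := by
  rw [Fintype.sum_prod_type]
  exact (Matrix.matrix_eq_sum_single X).symm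

theorem sum_centeredSample (X : Matrix (Fin n) (Fin n) ℝ) : ∑ i, centeredSample X i = 0 := by
  simp only [centeredSample, Finset.sum_sub_distrib, ← Finset.smul_sum, sum_single_eq,
    Finset.sum_const, Finset.card_univ, Fintype.card_prod, Fintype.card_fin,
    ← Nat.cast_smul_eq_nsmul ℝ]
  push_cast
  rw [pow_two, sub_self]

theorem sampling_sub_eq {m : ℕ} (hm : m ≠ 0) (X : Matrix (Fin n) (Fin n) ℝ)
    (w : Fin m → Fin n × Fin n) :
    ((m : ℝ) / (n : ℝ) ^ 2)⁻¹ • sampling w X - X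
      = (m : ℝ)⁻¹ • ∑ k, centeredSample X (w k) := by
  have hs : sampling w X = ∑ k, Matrix.single (w k).1 (w k).2 (X (w k).1 (w k).2) := by
    ext a b
    simp only [sampling, Matrix.hadamard_apply, Matrix.sum_apply, Finset.mul_sum]
    refine Finset.sum_congr rfl fun k _ => ?_
    by_cases h : (w k).1 = a ∧ (w k).2 = b
    · obtain ⟨rfl, rfl⟩ := h
      simp
    · simp [h]
  have hm' : (m : ℝ) ≠ 0 := Nat.cast_ne_zero.2 hm
  simp only [hs, centeredSample, Finset.sum_sub_distrib, ← Finset.smul_sum, Finset.sum_const,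
    Finset.card_univ, Fintype.card_fin, ← Nat.cast_smul_eq_nsmul ℝ, smul_sub, smul_smul]
  rw [inv_mul_cancel₀ hm', one_smul, inv_div, div_eq_inv_mul]

theorem abs_apply_le_maxNorm (X : Matrix (Fin n) (Fin n) ℝ) (i j : Fin n) :
    |X i j| ≤ maxNorm X := by
  open scoped Matrix.Norms.Elementwise in
  exact Matrix.norm_entry_le_entrywise_sup_norm X

theorem maxNorm_nonneg (X : Matrix (Fin n) (Fin n) ℝ) : 0 ≤ maxNorm X := by
  open scoped Matrix.Norms.Elementwise in
  exact norm_nonneg X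

theorem sq_apply_le_maxNorm_sq (X : Matrix (Fin n) (Fin n) ℝ) (i j : Fin n) :
    X i j ^ 2 ≤ maxNorm X ^ 2 :=
  sq_le_sq' (neg_le_of_abs_le (abs_apply_le_maxNorm X i j))
    (le_of_abs_le (abs_apply_le_maxNorm X i j))

theorem maxNorm_transpose (X : Matrix (Fin n) (Fin n) ℝ) : maxNorm Xᵀ = maxNorm X := by
  open scoped Matrix.Norms.Elementwise in
  exact Matrix.norm_transpose X

theorem specNorm_le_mul_maxNorm (X : Matrix (Fin n) (Fin n) ℝ) :
    specNorm X ≤ n * maxNorm X := by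
  refine specNorm_le_of_sum_sq_le (mul_nonneg n.cast_nonneg (maxNorm_nonneg X)) ?_
  calc ∑ i, ∑ j, X i j ^ 2 ≤ ∑ _i : Fin n, ∑ _j : Fin n, maxNorm X ^ 2 :=
        Finset.sum_le_sum fun i _ => Finset.sum_le_sum fun j _ => sq_apply_le_maxNorm_sq X i j
    _ = _ := by simp; ring

theorem specNorm_single_le (i j : Fin n) (c : ℝ) : specNorm (Matrix.single i j c) ≤ |c| := by
  refine specNorm_le_of_sum_sq_le (abs_nonneg c) ?_
  rw [Finset.sum_eq_single i, Finset.sum_eq_single j]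
  · simp
  · intro b _ hb
    simp [hb.symm]
  · simp
  · intro a _ ha
    simp [ha.symm]
  · simp

/-- The two terms contribute `n² B` and `n B`; `n ≥ 2` gives `n ≤ n² / 2`. -/
theorem specNorm_centeredSample_le (hn : 2 ≤ n) (X : Matrix (Fin n) (Fin n) ℝ)
    (i : Fin n × Fin n) : specNorm (centeredSample X i) ≤ 3 / 2 * (n : ℝ) ^ 2 * maxNorm X := by
  have hn' : (2 : ℝ) ≤ n := by exact_mod_cast hn
  have h₁ : specNorm ((n : ℝ) ^ 2 • Matrix.single i.1 i.2 (X i.1 i.2))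
      ≤ (n : ℝ) ^ 2 * maxNorm X := by
    rw [specNorm_smul, abs_of_nonneg (by positivity)]
    gcongr
    exact (specNorm_single_le _ _ _).trans (abs_apply_le_maxNorm X _ _)
  have h₂ := specNorm_le_mul_maxNorm X
  have h₃ := specNorm_add_le ((n : ℝ) ^ 2 • Matrix.single i.1 i.2 (X i.1 i.2)) (-X)
  rw [specNorm_neg, ← sub_eq_add_neg] at h₃
  have h₄ : (n : ℝ) * maxNorm X ≤ (n : ℝ) ^ 2 / 2 * maxNorm X := by
    have := maxNorm_nonneg X
    gcongr
    nlinarith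
  unfold centeredSample
  linarith

/-- The single-entry matrices sum to `X`, so the two cross terms remove `2n² X Xᵀ` and the constant
term restores `n² X Xᵀ`. -/
theorem sum_centeredSample_mul_transpose (X : Matrix (Fin n) (Fin n) ℝ) :
    ∑ i, centeredSample X i * (centeredSample X i)ᵀ =
      (n : ℝ) ^ 4 • Matrix.diagonal (fun i => ∑ j, X i j ^ 2) - (n : ℝ) ^ 2 • (X * Xᵀ) := by
  set E : Fin n × Fin n → Matrix (Fin n) (Fin n) ℝ :=
    fun i => Matrix.single i.1 i.2 (X i.1 i.2) with hE
  have hEsum : ∑ i, E i = X := sum_single_eq X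
  have hEE : ∑ i, E i * (E i)ᵀ = Matrix.diagonal (fun i => ∑ j, X i j ^ 2) := by
    simp only [hE, Matrix.transpose_single, Matrix.single_mul_single_same]
    rw [Fintype.sum_prod_type]
    ext a b
    simp only [Matrix.sum_apply, Matrix.single_apply, Matrix.diagonal_apply]
    by_cases hab : a = b
    · subst hab
      simp [pow_two]
    · simp only [hab, if_false]
      refine Finset.sum_eq_zero fun c _ => Finset.sum_eq_zero fun d _ => if_neg ?_
      rintro ⟨rfl, rfl⟩
      exact hab rfl
  have hexp : ∀ i, centeredSample X i * (centeredSample X i)ᵀ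
      = (n : ℝ) ^ 4 • (E i * (E i)ᵀ) - (n : ℝ) ^ 2 • (E i * Xᵀ) - (n : ℝ) ^ 2 • (X * (E i)ᵀ)
        + X * Xᵀ := fun i => by
    simp only [centeredSample, hE, Matrix.transpose_sub, Matrix.transpose_smul, sub_mul, mul_sub,
      Matrix.smul_mul, Matrix.mul_smul, smul_smul]
    rw [show (n : ℝ) ^ 2 * (n : ℝ) ^ 2 = (n : ℝ) ^ 4 by ring]
    abel
  simp only [hexp, Finset.sum_add_distrib, Finset.sum_sub_distrib, ← Finset.smul_sum, hEE,
    ← Finset.sum_mul, ← Finset.mul_sum, ← Matrix.transpose_sum, hEsum, Finset.sum_const,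
    Finset.card_univ, Fintype.card_prod, Fintype.card_fin, ← Nat.cast_smul_eq_nsmul ℝ]
  push_cast
  rw [← pow_two, Matrix.smul_mul]
  abel

/-- Each row has squared norm at most `n B²`, and the `-n² X Xᵀ` in the variance only helps. -/
theorem posSemidef_sub_sum_centeredSample_mul_transpose (X : Matrix (Fin n) (Fin n) ℝ) :
    ((Fintype.card (Fin n × Fin n) * ((n : ℝ) ^ 3 * maxNorm X ^ 2)) •
      (1 : Matrix (Fin n) (Fin n) ℝ)
        - ∑ i, centeredSample X i * (centeredSample X i)ᵀ).PosSemidef := by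
  have h₁ : (Matrix.diagonal
      (fun i => (n : ℝ) ^ 5 * maxNorm X ^ 2 - (n : ℝ) ^ 4 * ∑ j, X i j ^ 2)).PosSemidef := by
    refine Matrix.posSemidef_diagonal_iff.2 fun i => ?_
    have : ∑ j, X i j ^ 2 ≤ n * maxNorm X ^ 2 := by
      simpa using Finset.sum_le_sum fun j (_ : j ∈ Finset.univ) => sq_apply_le_maxNorm_sq X i j
    have := mul_le_mul_of_nonneg_left this (by positivity : (0 : ℝ) ≤ (n : ℝ) ^ 4)
    linarith
  have h₂ := (Matrix.posSemidef_self_mul_conjTranspose X).smul (sq_nonneg (n : ℝ))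
  convert! h₁.add h₂ using 1
  rw [sum_centeredSample_mul_transpose, Matrix.conjTranspose_eq_transpose_of_trivial,
    ← Matrix.diagonal_sub, ← Matrix.smul_one_eq_diagonal, Fintype.card_prod, Fintype.card_fin,
    show ((n * n : ℕ) : ℝ) * ((n : ℝ) ^ 3 * maxNorm X ^ 2) = (n : ℝ) ^ 5 * maxNorm X ^ 2 by
      push_cast; ring, sub_sub_eq_add_sub, add_sub_right_comm]
  congr 2
  rw [← Matrix.diagonal_smul]
  rfl

theorem posSemidef_sub_sum_transpose_mul_centeredSample (X : Matrix (Fin n) (Fin n) ℝ) :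
    ((Fintype.card (Fin n × Fin n) * ((n : ℝ) ^ 3 * maxNorm X ^ 2)) •
      (1 : Matrix (Fin n) (Fin n) ℝ)
        - ∑ i, (centeredSample X i)ᵀ * centeredSample X i).PosSemidef := by
  have h := posSemidef_sub_sum_centeredSample_mul_transpose Xᵀ
  rw [maxNorm_transpose, ← (Equiv.prodComm (Fin n) (Fin n)).sum_comp] at h
  convert h using 3 with i
  have : centeredSample Xᵀ (Equiv.prodComm (Fin n) (Fin n) i) = (centeredSample X i)ᵀ := by
    simp [centeredSample, Matrix.transpose_single]
  rw [this, Matrix.transpose_transpose]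

/-- The number of samples for which the rescaled sampling operator is far from the identity. -/
theorem card_lt_specNorm_sampling_sub_le {m : ℕ} (hn : 2 ≤ n) {X : Matrix (Fin n) (Fin n) ℝ}
    (hX : 0 < maxNorm X) {β : ℝ} (hβ : 0 < β) (hm : 6 * β * n * Real.log n ≤ m) :
    (Set.ncard {w : Fin m → Fin n × Fin n |
      √(8 * β * n ^ 3 * Real.log n / (3 * m)) * maxNorm X
        < specNorm (((m : ℝ) / (n : ℝ) ^ 2)⁻¹ • sampling w X - X)} : ℝ) ≤
      ((n : ℝ) ^ 2) ^ m * (2 * (n : ℝ) ^ (1 - β)) := by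
  have hn' : (2 : ℝ) ≤ n := by exact_mod_cast hn
  have hn₀ : (0 : ℝ) < n := by linarith
  have hL : 0 < Real.log n := Real.log_pos (by linarith)
  have hm₀ : (0 : ℝ) < m := lt_of_lt_of_le (by positivity) hm
  have : Nonempty (Fin n) := ⟨⟨0, by omega⟩⟩
  set B := maxNorm X with hB
  set L := Real.log n with hLdef
  set τ := √(8 * β * n ^ 3 * L / (3 * m)) * B with hτ
  have hτ₀ : 0 < τ := by positivity
  have hτsq : τ ^ 2 = 8 * β * n ^ 3 * L / (3 * m) * B ^ 2 := by
    rw [hτ, mul_pow, Real.sq_sqrt (by positivity)]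
  set V := (n : ℝ) ^ 3 * B ^ 2 with hV
  have hV₀ : 0 < V := by positivity
  set M := 3 / 2 * (n : ℝ) ^ 2 * B with hM
  have hM₀ : 0 < M := by positivity
  -- Bernstein's choice of `θ`: the moment exponent per sample becomes `θ τ / 2`, half of the
  -- Chernoff gain `θ τ`.
  set θ := τ / (V + M * τ / 3) with hθ
  have hden : 0 < V + M * τ / 3 := by positivity
  have hθ₀ : 0 < θ := by positivity
  have h1 : 1 - θ * M / 3 = V / (V + M * τ / 3) := by
    rw [hθ]; field_simp; ring
  have hθM : θ * M < 3 := by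
    have : 0 < 1 - θ * M / 3 := by rw [h1]; positivity
    linarith
  have hbound := card_lt_specNorm_mul_exp_le (sum_centeredSample X) hM₀.le hV₀.le hθ₀.le hθM
    (t := m * τ) (by positivity) (specNorm_centeredSample_le hn X)
    (posSemidef_sub_sum_centeredSample_mul_transpose X)
    (posSemidef_sub_sum_transpose_mul_centeredSample X) m
  have hset : {w : Fin m → Fin n × Fin n |
      τ < specNorm (((m : ℝ) / (n : ℝ) ^ 2)⁻¹ • sampling w X - X)}
      = {w | m * τ < specNorm (∑ k, centeredSample X (w k))} := by
    ext w
    rw [Set.mem_ofPred_eq, Set.mem_ofPred_eq, sampling_sub_eq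
      (by rintro rfl; simp at hm₀), specNorm_smul, abs_of_nonneg (by positivity),
      lt_inv_mul_iff₀ hm₀]
  rw [hset]
  have hgV : (2 * (1 - θ * M / 3))⁻¹ * θ ^ 2 * V = θ * τ / 2 := by
    rw [h1, hθ]; field_simp
  rw [hgV, Fintype.card_prod, Fintype.card_fin] at hbound
  -- The sample size assumption enters here. It gives `M τ / 3 ≤ V / 3`, and with denominator `4V/3`
  -- the exponent `3mτ²/(8V)` is exactly `β log n`.
  have hτle : τ ≤ 2 / 3 * n * B := by
    refine le_of_sq_le_sq ?_ (by positivity)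
    rw [hτsq, mul_pow]
    gcongr
    rw [div_le_iff₀ (by positivity)]
    have := mul_le_mul_of_nonneg_left hm (by positivity : (0 : ℝ) ≤ 4 / 3 * n ^ 2)
    linarith
  have hkey : β * L ≤ m * (θ * τ / 2) := by
    have hd : V + M * τ / 3 ≤ 4 / 3 * V := by
      have := mul_le_mul_of_nonneg_left hτle (by positivity : (0 : ℝ) ≤ 1 / 2 * n ^ 2 * B)
      rw [hV, hM]
      linarith
    have h2 : m * (θ * τ / 2) = m * τ ^ 2 / 2 / (V + M * τ / 3) := by rw [hθ]; field_simp
    rw [h2, le_div_iff₀ hden, hτsq]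
    calc β * L * (V + M * τ / 3) ≤ β * L * (4 / 3 * V) := by gcongr
      _ = _ := by rw [hV]; field_simp; ring
  have hexp : Real.exp (m * (θ * τ / 2)) * (2 * n) ≤ 2 * (n : ℝ) ^ (1 - β)
      * Real.exp (θ * (m * τ)) := by
    have h3 : (n : ℝ) ^ (1 - β) = n * Real.exp (-(β * L)) := by
      rw [sub_eq_add_neg, Real.rpow_add hn₀, Real.rpow_one, Real.rpow_def_of_pos hn₀]
      congr 2
      ring
    have h4 : Real.exp (m * (θ * τ / 2)) ≤ Real.exp (-(β * L)) * Real.exp (θ * (m * τ)) := by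
      rw [← Real.exp_add]
      refine Real.exp_le_exp.2 ?_
      linarith
    rw [h3]
    nlinarith
  refine le_of_mul_le_mul_right (hbound.trans ?_) (Real.exp_pos (θ * (m * τ)))
  rw [Nat.cast_mul, ← pow_two, mul_assoc, mul_assoc]
  gcongr

end Sampling

end MatrixCompletion

namespace MatrixCompletion

/-! ### Deterministic error of hard thresholding. -/

section Thresholding

variable {n : ℕ}

theorem frobNorm_sq (A : Matrix (Fin n) (Fin n) ℝ) : frobNorm A ^ 2 = (Aᵀ * A).trace := by
  have h : frobNorm A = √(∑ i, ∑ j, A i j ^ 2) := by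
    open scoped Matrix.Norms.Frobenius in
    rw [frobNorm, Matrix.frobenius_norm_def, Real.sqrt_eq_rpow]
    simp
  rw [h, Real.sq_sqrt (by positivity), Finset.sum_comm]
  simp [Matrix.trace, Matrix.mul_apply, pow_two]

theorem dotProduct_mulVec_orthogonal {P : Matrix (Fin n) (Fin n) ℝ}
    (hP : P ∈ Matrix.orthogonalGroup (Fin n) ℝ) (v : Fin n → ℝ) :
    P *ᵥ v ⬝ᵥ P *ᵥ v = v ⬝ᵥ v := by
  have h : Pᵀ * P = 1 := (Matrix.mem_orthogonalGroup_iff' (Fin n) ℝ).1 hP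
  rw [Matrix.dotProduct_mulVec, ← Matrix.mulVec_transpose, Matrix.mulVec_mulVec, h,
    Matrix.one_mulVec]

theorem transpose_mem_orthogonalGroup {P : Matrix (Fin n) (Fin n) ℝ}
    (hP : P ∈ Matrix.orthogonalGroup (Fin n) ℝ) : Pᵀ ∈ Matrix.orthogonalGroup (Fin n) ℝ := by
  rw [Matrix.mem_orthogonalGroup_iff]
  simpa using (Matrix.mem_orthogonalGroup_iff' (Fin n) ℝ).1 hP

theorem dotProduct_mulVec_conj_diagonal {P Q : Matrix (Fin n) (Fin n) ℝ}
    (hP : P ∈ Matrix.orthogonalGroup (Fin n) ℝ) (d v : Fin n → ℝ) :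
    (P * Matrix.diagonal d * Qᵀ) *ᵥ v ⬝ᵥ (P * Matrix.diagonal d * Qᵀ) *ᵥ v
      = ∑ i, d i ^ 2 * (Qᵀ *ᵥ v) i ^ 2 := by
  rw [Matrix.mul_assoc, ← Matrix.mulVec_mulVec, dotProduct_mulVec_orthogonal hP,
    ← Matrix.mulVec_mulVec, dotProduct]
  simp only [Matrix.mulVec_diagonal]
  exact Finset.sum_congr rfl fun i _ => by ring

theorem specNorm_conj_diagonal_le {P Q : Matrix (Fin n) (Fin n) ℝ}
    (hP : P ∈ Matrix.orthogonalGroup (Fin n) ℝ) (hQ : Q ∈ Matrix.orthogonalGroup (Fin n) ℝ)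
    {d : Fin n → ℝ} {t : ℝ} (ht : 0 ≤ t) (hd : ∀ i, |d i| ≤ t) :
    specNorm (P * Matrix.diagonal d * Qᵀ) ≤ t := by
  refine specNorm_le ht fun v => ?_
  rw [dotProduct_mulVec_conj_diagonal hP,
    ← dotProduct_mulVec_orthogonal (transpose_mem_orthogonalGroup hQ) v, dotProduct,
    Finset.mul_sum]
  refine Finset.sum_le_sum fun i _ => ?_
  rw [← pow_two, ← sq_abs (d i)]
  gcongr
  exact hd i

theorem rank_conj_diagonal {P Q : Matrix (Fin n) (Fin n) ℝ}
    (hP : P ∈ Matrix.orthogonalGroup (Fin n) ℝ) (hQ : Q ∈ Matrix.orthogonalGroup (Fin n) ℝ)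
    (d : Fin n → ℝ) :
    (P * Matrix.diagonal d * Qᵀ).rank = Fintype.card {i // d i ≠ 0} := by
  have hPdet : IsUnit P.det := (Matrix.isUnit_iff_isUnit_det P).1
    (IsUnit.of_mul_eq_one _ ((Matrix.mem_orthogonalGroup_iff (Fin n) ℝ).1 hP))
  have hQdet : IsUnit Qᵀ.det := (Matrix.isUnit_iff_isUnit_det Qᵀ).1
    (IsUnit.of_mul_eq_one _ ((Matrix.mem_orthogonalGroup_iff' (Fin n) ℝ).1 hQ))
  rw [Matrix.rank_mul_eq_left_of_isUnit_det _ _ hQdet,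
    Matrix.rank_mul_eq_right_of_isUnit_det _ _ hPdet, Matrix.rank_diagonal]

/-- Test `Z` on the `i`-th column of `Q`. -/
theorem IsSVD.le_specNorm {Z P Q : Matrix (Fin n) (Fin n) ℝ} {s : Fin n → ℝ}
    (h : IsSVD Z P s Q) (i : Fin n) : s i ≤ specNorm Z := by
  have hQ : Qᵀ * Q = 1 := (Matrix.mem_orthogonalGroup_iff' (Fin n) ℝ).1 h.right_mem
  have h1 := mulVec_dotProduct_mulVec_le Z (Q *ᵥ Pi.single i 1)
  rw [dotProduct_mulVec_orthogonal h.right_mem, h.eq,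
    dotProduct_mulVec_conj_diagonal h.left_mem, Matrix.mulVec_mulVec, hQ, Matrix.one_mulVec,
    Finset.sum_eq_single i (fun j _ hj => by simp [hj]) (by simp), ← h.eq] at h1
  exact le_of_sq_le_sq (by simpa using h1) (specNorm_nonneg Z)

/-- The squared Frobenius norm is the sum of the squared singular values, of which only rank many
are nonzero. -/
theorem frobNorm_le_sqrt_rank_mul_specNorm (A : Matrix (Fin n) (Fin n) ℝ) :
    frobNorm A ≤ √A.rank * specNorm A := by
  obtain ⟨P, s, Q, h⟩ := exists_isSVD A
  have hP : Pᵀ * P = 1 := (Matrix.mem_orthogonalGroup_iff' (Fin n) ℝ).1 h.left_mem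
  have hQ : Qᵀ * Q = 1 := (Matrix.mem_orthogonalGroup_iff' (Fin n) ℝ).1 h.right_mem
  refine le_of_sq_le_sq ?_ (mul_nonneg (Real.sqrt_nonneg _) (specNorm_nonneg A))
  have htr : frobNorm A ^ 2 = ∑ i, s i ^ 2 := by
    have hAA : Aᵀ * A = Q * (Matrix.diagonal s * (Pᵀ * P) * Matrix.diagonal s * Qᵀ) := by
      rw [h.eq, Matrix.transpose_mul, Matrix.transpose_mul, Matrix.transpose_transpose,
        Matrix.diagonal_transpose]
      simp only [Matrix.mul_assoc]
    rw [frobNorm_sq, hAA, hP, mul_one, Matrix.diagonal_mul_diagonal, Matrix.trace_mul_comm,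
      Matrix.mul_assoc, hQ, mul_one, Matrix.trace_diagonal]
    simp [pow_two]
  have hrank : (A.rank : ℝ) = ∑ i, if s i ≠ 0 then (1 : ℝ) else 0 := by
    conv_lhs => rw [h.eq, rank_conj_diagonal h.left_mem h.right_mem, Fintype.card_subtype]
    exact Finset.natCast_card_filter _ _
  rw [htr, mul_pow, Real.sq_sqrt (Nat.cast_nonneg _), hrank, Finset.sum_mul]
  refine Finset.sum_le_sum fun i _ => ?_
  split_ifs with hi
  · rw [one_mul]
    have := h.nonneg i
    gcongr
    exact h.le_specNorm i
  · rw [not_not.1 hi]; simp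

/-- Eckart–Young: a singular value of index at least `r` is at most the spectral distance to
matrices of rank at most `r`. -/
theorem IsSVD.le_specNorm_sub {Z P Q : Matrix (Fin n) (Fin n) ℝ} {s : Fin n → ℝ}
    (h : IsSVD Z P s Q) {X : Matrix (Fin n) (Fin n) ℝ} {r : ℕ} (hX : X.rank ≤ r) {i : Fin n}
    (hi : r ≤ i) : s i ≤ specNorm (Z - X) := by
  have hQ : Qᵀ * Q = 1 := (Matrix.mem_orthogonalGroup_iff' (Fin n) ℝ).1 h.right_mem
  have hrn : r + 1 ≤ n := by omega
  set e : Fin (r + 1) → Fin n := Fin.castLE hrn with he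
  have hinj : Function.Injective e := Fin.castLE_injective hrn
  -- This is `X` restricted to the span of the first `r + 1` right singular vectors. Its rank is at
  -- most `r`, so it kills a nonzero vector, on which `Z - X` acts as `Z`.
  set f := X.mulVecLin ∘ₗ Q.mulVecLin ∘ₗ Function.ExtendByZero.linearMap ℝ e with hf
  obtain ⟨u, hu, hfu⟩ : ∃ u, u ≠ 0 ∧ f u = 0 := by
    by_contra! hcon
    have hfinj : Function.Injective f := (injective_iff_map_eq_zero f).2 fun u hu => by
      by_contra hne
      exact hcon u hne hu
    have h1 := LinearMap.finrank_range_of_inj hfinj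
    have h2 : LinearMap.range f ≤ LinearMap.range X.mulVecLin := LinearMap.range_comp_le_range _ _
    have h3 := Submodule.finrank_mono h2
    rw [h1, Module.finrank_fin_fun] at h3
    exact absurd (h3.trans hX) (by omega)
  set c : Fin n → ℝ := Function.extend e u 0 with hc
  have hXc : X *ᵥ (Q *ᵥ c) = 0 := hfu
  have hc₀ : 0 < c ⬝ᵥ c := by
    obtain ⟨j, hj⟩ := Function.ne_iff.1 hu
    have hcj : c (e j) = u j := hinj.extend_apply _ _ _
    refine Finset.sum_pos' (fun k _ => mul_self_nonneg _) ⟨e j, Finset.mem_univ _, ?_⟩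
    rw [hcj]
    exact mul_self_pos.2 hj
  have hcs : ∀ k, s i ^ 2 * (c k * c k) ≤ s k ^ 2 * c k ^ 2 := fun k => by
    by_cases hk : ∃ j, e j = k
    · obtain ⟨j, rfl⟩ := hk
      have hle : e j ≤ i := by
        rw [Fin.le_def, he, Fin.val_castLE]
        omega
      have := h.antitone hle
      have := h.nonneg i
      rw [← pow_two]
      gcongr
    · rw [hc, Function.extend_apply' _ _ _ hk]
      simp
  have h1 := mulVec_dotProduct_mulVec_le (Z - X) (Q *ᵥ c)
  rw [Matrix.sub_mulVec, hXc, sub_zero, dotProduct_mulVec_orthogonal h.right_mem] at h1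
  have h2 : s i ^ 2 * (c ⬝ᵥ c) ≤ Z *ᵥ (Q *ᵥ c) ⬝ᵥ Z *ᵥ (Q *ᵥ c) := by
    rw [h.eq, dotProduct_mulVec_conj_diagonal h.left_mem, Matrix.mulVec_mulVec c Qᵀ Q, hQ,
      Matrix.one_mulVec, dotProduct, Finset.mul_sum]
    exact Finset.sum_le_sum fun k _ => hcs k
  exact le_of_sq_le_sq (le_of_mul_le_mul_right (h2.trans h1) hc₀) (specNorm_nonneg _)

theorem rank_sub_le (A B : Matrix (Fin n) (Fin n) ℝ) : (A - B).rank ≤ A.rank + B.rank := by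
  have h : LinearMap.range (A - B).mulVecLin
      ≤ LinearMap.range A.mulVecLin ⊔ LinearMap.range B.mulVecLin := by
    rintro _ ⟨v, rfl⟩
    rw [Matrix.mulVecLin_apply, Matrix.sub_mulVec]
    exact Submodule.sub_mem _ (Submodule.mem_sup_left ⟨v, rfl⟩) (Submodule.mem_sup_right ⟨v, rfl⟩)
  exact (Submodule.finrank_mono h).trans (Submodule.finrank_add_le_finrank_add_finrank _ _)

/-- Truncation discards only singular values of index at least `r`, so `Y - Z` is no larger in
spectral norm than `Z - X`. The triangle inequality and the rank bound `2r` finish. -/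
theorem IsHardThresholding.frobNorm_sub_le {r : ℕ} {Z Y X : Matrix (Fin n) (Fin n) ℝ}
    (hY : IsHardThresholding r Z Y) (hX : X.rank ≤ r) :
    frobNorm (Y - X) ≤ √(2 * r) * (2 * specNorm (Z - X)) := by
  obtain ⟨P, s, Q, h, rfl⟩ := hY
  set d : Fin n → ℝ := fun i => if (i : ℕ) < r then s i else 0 with hd
  set Y := P * Matrix.diagonal d * Qᵀ with hYdef
  have hYrank : Y.rank ≤ r := by
    rw [hYdef, rank_conj_diagonal h.left_mem h.right_mem, ← Fintype.card_fin r]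
    have hlt : ∀ i : {i // d i ≠ 0}, (i : Fin n).val < r := fun i => by
      by_contra hi
      exact i.2 (if_neg hi)
    rw [Fintype.card_fin r]
    calc _ ≤ Fintype.card (Fin r) := Fintype.card_le_of_injective (fun i => ⟨_, hlt i⟩)
          fun i j hij => Subtype.ext (Fin.ext (by simpa using hij))
      _ = r := Fintype.card_fin r
  have hrank : (Y - X).rank ≤ 2 * r := by
    have := rank_sub_le Y X
    omega
  have hZY : specNorm (Y - Z) ≤ specNorm (Z - X) := by
    have : Y - Z = P * Matrix.diagonal (fun i => d i - s i) * Qᵀ := by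
      rw [hYdef, h.eq, ← sub_mul, ← mul_sub, Matrix.diagonal_sub]
    rw [this]
    refine specNorm_conj_diagonal_le h.left_mem h.right_mem (specNorm_nonneg _) fun i => ?_
    by_cases hi : (i : ℕ) < r
    · simpa [hd, hi] using specNorm_nonneg _
    · simpa [hd, hi, abs_of_nonneg (h.nonneg i)] using h.le_specNorm_sub hX (not_lt.1 hi)
  have hYX : specNorm (Y - X) ≤ 2 * specNorm (Z - X) := by
    have := specNorm_add_le (Y - Z) (Z - X)
    rw [sub_add_sub_cancel] at this
    linarith
  refine (frobNorm_le_sqrt_rank_mul_specNorm _).trans ?_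
  have := specNorm_nonneg (Y - X)
  gcongr
  exact_mod_cast hrank

end Thresholding

/-! ### From counting to probability, and the final assembly. -/

/-- Under independent uniform sampling, the probability of a set of samples is at most its
relative size. -/
theorem measureReal_sample_mem_le {I S : Type*} [Fintype I] [MeasurableSpace I]
    [MeasurableSingletonClass I] [MeasurableSpace S] {P : Measure S} [IsProbabilityMeasure P]
    {m : ℕ} {Ω : Fin m → S → I} (hmeas : ∀ k, Measurable (Ω k))
    (hunif : ∀ k, P.map (Ω k) = uniformOn Set.univ) (hindep : iIndepFun Ω P)
    (B : Set (Fin m → I)) :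
    P.real {ω | (fun k => Ω k ω) ∈ B} ≤ B.ncard / (Fintype.card I : ℝ) ^ m := by
  classical
  have hpt : ∀ w : Fin m → I,
      P.real {ω | (fun k => Ω k ω) = w} = ((Fintype.card I : ℝ) ^ m)⁻¹ := fun w => by
    have hset : {ω | (fun k => Ω k ω) = w}
        = ⋂ k ∈ (Finset.univ : Finset (Fin m)), Ω k ⁻¹' {w k} := by
      ext ω
      simp [funext_iff]
    have h1 : ∀ k, P (Ω k ⁻¹' {w k}) = (Fintype.card I : ENNReal)⁻¹ := fun k => by
      rw [← Measure.map_apply (hmeas k) (measurableSet_singleton _), hunif k, uniformOn_univ]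
      simp
    rw [hset, measureReal_def, hindep.measure_inter_preimage_eq_mul Finset.univ
      fun k _ => measurableSet_singleton _]
    simp [h1]
  have hset : {ω | (fun k => Ω k ω) ∈ B} = ⋃ w ∈ B.toFinset, {ω | (fun k => Ω k ω) = w} := by
    ext ω
    simp
  rw [hset]
  refine (measureReal_biUnion_finset_le _ _).trans ?_
  simp only [hpt, Finset.sum_const, nsmul_eq_mul]
  rw [Set.ncard_eq_toFinset_card', div_eq_mul_inv]

theorem maxNorm_eq_zero {n : ℕ} {X : Matrix (Fin n) (Fin n) ℝ} (h : maxNorm X = 0) : X = 0 := by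
  ext i j
  have := abs_apply_le_maxNorm X i j
  rw [h] at this
  simpa using this

/-- Monotonicity and subadditivity suffice, so the good event need not be shown measurable. -/
theorem one_sub_le_measureReal_of_compl {S : Type*} [MeasurableSpace S] {P : Measure S}
    [IsProbabilityMeasure P] {G B : Set S} (h : Gᶜ ⊆ B) {c : ℝ} (hB : P.real B ≤ c) :
    1 - c ≤ P.real G := by
  have h1 : P.real (Set.univ : Set S) ≤ P.real G + P.real B := by
    refine (measureReal_mono (fun x _ => ?_)).trans (measureReal_union_le G B)
    by_cases hx : x ∈ G
    · exact Or.inl hx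
    · exact Or.inr (h hx)
  rw [probReal_univ] at h1
  linarith

/-- The numerical comparison between the deviation level and the stated error bound. -/
theorem error_level_le {n r m : ℕ} (hn : 0 < n) (hm : 0 < m) {β μ₁ B σ L : ℝ} (hβ : 0 ≤ β)
    (hL : 0 ≤ L) (hσ : 0 ≤ σ) (hB : 0 ≤ B) (h : B ≤ μ₁ * √((r : ℝ) / (n : ℝ) ^ 2) * σ) :
    √(2 * r) * (2 * (√(8 * β * n ^ 3 * L / (3 * m)) * B)) ≤
      √(64 * β * μ₁ ^ 2 * n * (r : ℝ) ^ 2 * L / (3 * m)) * σ := by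
  have hn' : (0 : ℝ) < n := by exact_mod_cast hn
  have hm' : (0 : ℝ) < m := by exact_mod_cast hm
  refine le_of_sq_le_sq ?_ (by positivity)
  -- As `0 ≤ B`, squaring is legitimate without knowing the sign of `μ₁`.
  have hB2 : B ^ 2 ≤ μ₁ ^ 2 * (r / (n : ℝ) ^ 2) * σ ^ 2 := by
    have := pow_le_pow_left₀ hB h 2
    rwa [mul_pow, mul_pow, Real.sq_sqrt (by positivity)] at this
  calc (√(2 * r) * (2 * (√(8 * β * n ^ 3 * L / (3 * m)) * B))) ^ 2
      = 2 * r * 4 * (8 * β * n ^ 3 * L / (3 * m)) * B ^ 2 := by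
        simp only [mul_pow]
        rw [Real.sq_sqrt (by positivity), Real.sq_sqrt (by positivity)]
        ring
    _ ≤ 2 * r * 4 * (8 * β * n ^ 3 * L / (3 * m)) * (μ₁ ^ 2 * (r / (n : ℝ) ^ 2) * σ ^ 2) := by
        gcongr
    _ = _ := by
        rw [mul_pow, Real.sq_sqrt (by positivity)]
        field_simp
        ring

end MatrixCompletion

theorem mainTheorem7 {n r m : ℕ} (hn : 1 ≤ n)
    (X : Matrix (Fin n) (Fin n) ℝ) (hr : X.rank = r)
    (μ₁ : ℝ) (hμ₁ : MatrixCompletion.maxNorm X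
      ≤ μ₁ * √((r : ℝ) / (n : ℝ) ^ 2) * MatrixCompletion.specNorm X)
    {S : Type*} [MeasurableSpace S] (P : Measure S) [IsProbabilityMeasure P]
    (Ω : Fin m → S → Fin n × Fin n)
    (hmeas : ∀ k, Measurable (Ω k))
    (hunif : ∀ k, P.map (Ω k) = uniformOn Set.univ)
    (hindep : iIndepFun Ω P)
    (β : ℝ) (hβ : 1 < β) (hm : 6 * β * n * Real.log n ≤ m) :
    1 - 2 * (n : ℝ) ^ (1 - β) ≤
      P.real {ω | ∀ X₀ : Matrix (Fin n) (Fin n) ℝ,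
        MatrixCompletion.IsHardThresholding r
          (((m : ℝ) / (n : ℝ) ^ 2)⁻¹ • MatrixCompletion.sampling (fun k => Ω k ω) X) X₀ →
        MatrixCompletion.frobNorm (X₀ - X) ≤
          √(64 * β * μ₁ ^ 2 * n * (r : ℝ) ^ 2 * Real.log n / (3 * m))
            * MatrixCompletion.specNorm X} := by
  open MatrixCompletion in
  -- For `n = 1` the claimed lower bound on the probability is `-1`.
  rcases hn.eq_or_lt with rfl | hn₂
  · simp only [Nat.cast_one, Real.one_rpow]
    have := measureReal_nonneg (μ := P) (s := {ω | ∀ X₀ : Matrix (Fin 1) (Fin 1) ℝ,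
      IsHardThresholding r
          (((m : ℝ) / (1 : ℝ) ^ 2)⁻¹ • sampling (fun k => Ω k ω) X) X₀ →
        frobNorm (X₀ - X) ≤
          √(64 * β * μ₁ ^ 2 * 1 * (r : ℝ) ^ 2 * Real.log 1 / (3 * m)) * specNorm X})
    linarith
  have hn₀ : (0 : ℝ) < n := by exact_mod_cast hn
  have hL : 0 < Real.log n := Real.log_pos (by exact_mod_cast hn₂)
  have hm₀ : 0 < m := by
    have : (0 : ℝ) < m := lt_of_lt_of_le (by positivity) hm
    exact_mod_cast this
  -- Bernstein needs a positive deviation level. If `X = 0` then `r = 0`, and the deterministic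
  -- bound already gives zero error.
  rcases (maxNorm_nonneg X).eq_or_lt with hB | hB
  · have hX : X = 0 := maxNorm_eq_zero hB.symm
    have hr₀ : r = 0 := by rw [← hr, hX, Matrix.rank_zero]
    refine one_sub_le_measureReal_of_compl (B := ∅) ?_ (by rw [measureReal_empty]; positivity)
    rw [Set.subset_empty_iff, Set.compl_empty_iff, Set.eq_univ_iff_forall]
    intro ω X₀ hX₀
    have h := hX₀.frobNorm_sub_le hr.le
    simp only [hr₀, Nat.cast_zero, mul_zero, Real.sqrt_zero, zero_mul] at h
    exact h.trans (mul_nonneg (Real.sqrt_nonneg _) (specNorm_nonneg X))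
  · refine one_sub_le_measureReal_of_compl (fun ω hω => ?_)
      ((measureReal_sample_mem_le hmeas hunif hindep
        {w | √(8 * β * n ^ 3 * Real.log n / (3 * m)) * maxNorm X
          < specNorm (((m : ℝ) / (n : ℝ) ^ 2)⁻¹ • sampling w X - X)}).trans ?_)
    · by_contra hω'
      rw [Set.mem_ofPred_eq, Set.mem_ofPred_eq, not_lt] at hω'
      refine hω fun X₀ hX₀ => ?_
      refine (hX₀.frobNorm_sub_le hr.le).trans (le_trans ?_ (error_level_le hn hm₀
        (by linarith) hL.le (specNorm_nonneg X) hB.le hμ₁))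
      gcongr
    · rw [Fintype.card_prod, Fintype.card_fin, Nat.cast_mul, ← pow_two,
        div_le_iff₀' (by positivity)]
      exact card_lt_specNorm_sampling_sub_le hn₂ hB (by linarith) hm
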